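/- Let $\mathcal S(n)$ be the space of symmetric real $n\times n$ matrices and $\mathcal J^2=\mathbb R\times\mathbb R^n\times\mathcal S(n)$. A subset $\mathcal F\subset\mathcal J^2$ has property (P) if $(r,p,A)\in\mathcal F$ and $P\ge 0$ imply $(r,p,A+P)\in\mathcal F$; property (N) if $(r,p,A)\in\mathcal F$ and $s\le 0$ imply $(r+s,p,A)\in\mathcal F$; and property (T) if $\mathcal F=\overline{\operatorname{Int}\mathcal F}$. A *subequation* is a non-empty proper subset of $\mathcal J^2$ with properties (P), (N) and (T). The *Dirichlet dual* of $\mathcal F\subset\mathcal J^2$ is $\widetilde{\mathcal F}=\mathcal J^2\setminus(-\operatorname{Int}\mathcal F)$. The set $\mathcal F$ is *$\mathcal M$-monotone* if $\mathcal F+\mathcal M\subset\mathcal F$. A *monotonicity cone subequation* is a closed convex cone $\mathcal M\subset\mathcal J^2$ with vertex at the origin that contains $\{(s,0,P): s\le 0,\ P\ge 0\}$ and has property (T). For $X\subset\mathbb R^n$ open, $\mathcal F(X)$ denotes the set of upper semicontinuous functions $u:X\to[-\infty,\infty)$ that are $\mathcal F$-subharmonic on $X$: for every $x_0\in X$ and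 every function $\varphi$ that is $C^2$ near $x_0$ and satisfies $u\le\varphi$ near $x_0$ and $u(x_0)=\varphi(x_0)$, one has $(\varphi(x_0),D\varphi(x_0),D^2\varphi(x_0))\in\mathcal F$. **Theorem.** 1. (Subharmonic addition) If $\mathcal F,\mathcal G,\mathcal H\subset\mathcal J^2$ are subequations with $\mathcal F+\mathcal G\subset\mathcal H$, then $\mathcal F(X)+\mathcal G(X)\subset\mathcal H(X)$ for every open set $X\subset\mathbb R^n$. 2. (Jet addition, duality and monotonicity) If $\mathcal F,\mathcal H\subset\mathcal J^2$ are subequations, then $\mathcal F+\widetilde{\mathcal F}\subset\mathcal H$ if and only if $\mathcal F+\widetilde{\mathcal H}\subset\mathcal F$. Likewise, if $\mathcal F$ is a subequation and $\mathcal M\subset\mathcal J^2$ has property (T) (in particular, if $\mathcal M$ is a subequation or a monotonicity cone subequation), then $\mathcal F+\mathcal M\subset\mathcal F$ if and only if $\mathcal F+\widetilde{\mathcal F}\subset\widetilde{\mathcal M}$. 3. (Subharmonic addition, monotonicity and duality) If $\mathcal M$ is a monotonicity cone subequation and $\mathcal F$ is an $\mathcal M$-monotone subequation, then $\mathcal F(X)+\widetilde{\mathcal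 F}(X)\subset\widetilde{\mathcal M}(X)$ for every open set $X\subset\mathbb R^n$. -/

import Mathlib

open scoped Pointwise Topology

noncomputable section

/-- The space `𝒮(n)` of symmetric real `n × n` matrices. -/
def SymMat (n : ℕ) : Submodule ℝ (Matrix (Fin n) (Fin n) ℝ) where
  carrier := {A | A.IsSymm}
  add_mem' := fun hA hB => hA.add hB
  zero_mem' := Matrix.isSymm_zero
  smul_mem' := fun c _ hA => hA.smul c

/-- The space of 2-jets `𝒥² = ℝ × ℝⁿ × 𝒮(n)`, with coordinates `J = (r, p, A)`. -/
abbrev Jet2 (n : ℕ) : Type := ℝ × EuclideanSpace ℝ (Fin n) × SymMat n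

/-- The cone `𝒫` of symmetric matrices `P ≥ 0`. -/
def posCone (n : ℕ) : Set (SymMat n) :=
  {P | (P : Matrix (Fin n) (Fin n) ℝ).PosSemidef}

/-- Property (P). -/
def PropertyP {n : ℕ} (F : Set (Jet2 n)) : Prop :=
  ∀ r p A, (r, p, A) ∈ F → ∀ P ∈ posCone n, (r, p, A + P) ∈ F

/-- Property (N). -/
def PropertyN {n : ℕ} (F : Set (Jet2 n)) : Prop :=
  ∀ r p A, (r, p, A) ∈ F → ∀ s : ℝ, s ≤ 0 → (r + s, p, A) ∈ F

/-- Property (T): the set is the closure of its interior. -/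
def PropertyT {n : ℕ} (F : Set (Jet2 n)) : Prop :=
  F = closure (interior F)

/-- Subequation (constraint set). -/
structure IsSubequation {n : ℕ} (F : Set (Jet2 n)) : Prop where
  nonempty : F.Nonempty
  proper : F ≠ Set.univ
  propertyP : PropertyP F
  propertyN : PropertyN F
  propertyT : PropertyT F

/-- The Dirichlet dual: the complement of `-(Int F)`. -/
def dirichletDual {n : ℕ} (F : Set (Jet2 n)) : Set (Jet2 n) :=
  (-(interior F))ᶜ

/-- `F` is `M`-monotone. -/
def IsMonotoneFor {n : ℕ} (M F : Set (Jet2 n)) : Prop :=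
  F + M ⊆ F

/-- The minimal monotonicity set `𝒩 × {0} × 𝒫`. -/
def minimalMonotonicitySet (n : ℕ) : Set (Jet2 n) :=
  Set.Iic (0 : ℝ) ×ˢ ({0} : Set (EuclideanSpace ℝ (Fin n))) ×ˢ posCone n

/-- Monotonicity cone: a closed convex cone, with vertex at the origin, that contains
`𝒩 × {0} × 𝒫`. -/
structure IsMonotonicityCone {n : ℕ} (M : Set (Jet2 n)) : Prop where
  isClosed : IsClosed M
  convex : Convex ℝ M
  smul_mem : ∀ t : ℝ, 0 ≤ t → ∀ J ∈ M, t • J ∈ M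
  minimal_subset : minimalMonotonicitySet n ⊆ M

/-- Monotonicity cone subequation: a monotonicity cone with property (T). -/
structure IsMonotonicityConeSubequation {n : ℕ} (M : Set (Jet2 n)) : Prop
    extends IsMonotonicityCone M where
  propertyT : PropertyT M

/-- The Hessian matrix of `φ` at `x`, with entries `∂ᵢ∂ⱼ φ(x)`. -/
def hessianMatrix {n : ℕ} (φ : EuclideanSpace ℝ (Fin n) → ℝ)
    (x : EuclideanSpace ℝ (Fin n)) : Matrix (Fin n) (Fin n) ℝ :=
  Matrix.of fun i j =>
    fderiv ℝ (fderiv ℝ φ) x (EuclideanSpace.single i 1) (EuclideanSpace.single j 1)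

theorem hessianMatrix_mem_symMat {n : ℕ} {φ : EuclideanSpace ℝ (Fin n) → ℝ}
    {x : EuclideanSpace ℝ (Fin n)} (hφ : ContDiffAt ℝ 2 φ x) :
    hessianMatrix φ x ∈ SymMat n := by
  have h : IsSymmSndFDerivAt ℝ φ x := hφ.isSymmSndFDerivAt (by simp)
  change (hessianMatrix φ x).IsSymm
  ext i j
  exact h _ _

/-- The 2-jet `J²ₓ φ = (φ(x), Dφ(x), D²φ(x))` of a function that is `C²` near `x`. -/
def jet2At {n : ℕ} (φ : EuclideanSpace ℝ (Fin n) → ℝ) (x : EuclideanSpace ℝ (Fin n))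
    (hφ : ContDiffAt ℝ 2 φ x) : Jet2 n :=
  (φ x, gradient φ x, ⟨hessianMatrix φ x, hessianMatrix_mem_symMat hφ⟩)

/-- `u` is `F`-subharmonic at `x₀`: every upper test function `φ` for `u` at `x₀`
(`C²` near `x₀`, with `u ≤ φ` near `x₀` and `u(x₀) = φ(x₀)`) has its 2-jet at `x₀` in `F`. -/
def IsSubharmonicAt {n : ℕ} (F : Set (Jet2 n)) (u : EuclideanSpace ℝ (Fin n) → EReal)
    (x₀ : EuclideanSpace ℝ (Fin n)) : Prop :=
  ∀ (φ : EuclideanSpace ℝ (Fin n) → ℝ) (hφ : ContDiffAt ℝ 2 φ x₀),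
    (∀ᶠ x in 𝓝 x₀, u x ≤ (φ x : EReal)) → u x₀ = (φ x₀ : EReal) → jet2At φ x₀ hφ ∈ F

/-- The set `F(X)` of `F`-subharmonic functions on the open set `X`: upper semicontinuous,
with values in `[-∞, ∞)`, and `F`-subharmonic at each point of `X`. A function on `X` is
represented by a function on `ℝⁿ` whose values outside `X` are irrelevant. -/
def subharmonics {n : ℕ} (F : Set (Jet2 n)) (X : Set (EuclideanSpace ℝ (Fin n))) :
    Set (EuclideanSpace ℝ (Fin n) → EReal) :=
  {u | UpperSemicontinuousOn u X ∧ (∀ x ∈ X, u x < ⊤) ∧ ∀ x ∈ X, IsSubharmonicAt F u x}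

end

/-! Subharmonic addition is local. If `φ` touches `u + v` from above at `x₀`, Taylor expansion
replaces it by a quadratic `Q` with strict contact. Sup-convolutions `U`, `V` of `u`, `v` become
convex after adding `k/2‖x - x₀‖²`, with explicit subgradients built from the maximizers. Jensen's
argument gives a set of positive measure where a slightly tilted `Q` touches `U + V`; at almost
every point of it both subgradients are differentiable (`exists_contact_hasFDerivAt`), so `U` and
`V` have second-order expansions there. Up to a small error these expansions are upper test
functions, which translate back to `u` and `v` (`jet_mem_of_supConvolution`). Adding the two jets
lands in `H`, contact compares the Hessians, (P) and (N) move the jet close to that of `Q`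
(`exists_jet_mem_of_add_le`), and closedness of `H` finishes.

The jet statements rest on one implication, `F + G ⊆ H → F + H̃ ⊆ G̃` (`add_dirichletDual_subset`),
with reflexivity of the dual under (T). The last statement combines both halves. -/

noncomputable section

open MeasureTheory Filter Metric RealInnerProductSpace

/-! ### Convex functions through their subgradients -/

section Subgradient

variable {E : Type*} [NormedAddCommGroup E] [InnerProductSpace ℝ E]

/-- `g` selects a subgradient of `f` at every point (so `f` is convex). -/
def IsSubgradient (f : E → ℝ) (g : E → E) : Prop :=
  ∀ x y, f x + ⟪g x, y - x⟫ ≤ f y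

/-- A large jump of the subgradient would push `f` above the paraboloid at a point one step further
along `g x - g z`; the step has length `‖x - z‖` to stay in the region of the upper bound. -/
theorem IsSubgradient.norm_sub_le {f : E → ℝ} {g : E → E} (hg : IsSubgradient f g)
    {z : E} {c s : ℝ} (hup : ∀ y, ‖y - z‖ ≤ 2 * s → f y ≤ f z + ⟪g z, y - z⟫ + c / 2 * ‖y - z‖ ^ 2)
    (hc : 0 ≤ c) {x : E} (hx : ‖x - z‖ ≤ s) : ‖g x - g z‖ ≤ 2 * c * ‖x - z‖ := by
  by_cases hxz : x = z
  · simp [hxz]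
  by_cases hgg : g x = g z
  · rw [hgg, sub_self, norm_zero]; positivity
  have hd : 0 < ‖x - z‖ := norm_pos_iff.2 (sub_ne_zero.2 hxz)
  have hG : 0 < ‖g x - g z‖ := norm_pos_iff.2 (sub_ne_zero.2 hgg)
  set w : E := (‖x - z‖ / ‖g x - g z‖) • (g x - g z) with hw
  have hwn : ‖w‖ = ‖x - z‖ := by
    rw [hw, norm_smul, Real.norm_of_nonneg (by positivity)]; field_simp
  have hyz : ‖x + w - z‖ ≤ 2 * ‖x - z‖ := by
    calc ‖x + w - z‖ = ‖(x - z) + w‖ := by congr 1; abel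
      _ ≤ ‖x - z‖ + ‖w‖ := norm_add_le _ _
      _ = 2 * ‖x - z‖ := by rw [hwn]; ring
  have h1 := hup (x + w) (by linarith)
  have h2 := hg x (x + w)
  have h3 := hg z x
  have h4 : ‖x + w - z‖ ^ 2 ≤ (2 * ‖x - z‖) ^ 2 := by gcongr
  have h5 : ⟪g z, x + w - z⟫ = ⟪g z, x - z⟫ + ⟪g z, w⟫ := by
    rw [← inner_add_right]; congr 1; abel
  have h6 : ⟪g x, w⟫ - ⟪g z, w⟫ = ‖x - z‖ * ‖g x - g z‖ := by
    rw [← inner_sub_left, hw, inner_smul_right, real_inner_self_eq_norm_sq]; field_simp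
  rw [add_sub_cancel_left] at h2
  have h7 : c / 2 * ‖x + w - z‖ ^ 2 ≤ c / 2 * (2 * ‖x - z‖) ^ 2 := by gcongr
  have h8 : ‖x - z‖ * ‖g x - g z‖ ≤ ‖x - z‖ * (2 * c * ‖x - z‖) := by nlinarith
  exact le_of_mul_le_mul_left h8 hd

theorem IsSubgradient.lipschitzWith {f : E → ℝ} {g : E → E} (hg : IsSubgradient f g) {C : NNReal}
    (hC : ∀ x, ‖g x‖ ≤ C) : LipschitzWith C f := by
  refine LipschitzWith.of_le_add_mul C fun x y => ?_
  have h1 := hg x y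
  have h2 : |⟪g x, y - x⟫| ≤ C * ‖y - x‖ :=
    (abs_real_inner_le_norm _ _).trans (by gcongr; exact hC x)
  rw [dist_comm, dist_eq_norm]
  linarith [neg_abs_le ⟪g x, y - x⟫]

/-- Cut `[0, 1]` into `N + 1` equal pieces: the quadratic errors add up to `C / (N + 1)`. This
replaces integrating the subgradient along a segment. -/
theorem abs_sub_le_of_forall_abs_sub_le {φ : ℝ → ℝ} {a C : ℝ}
    (h : ∀ s t, 0 ≤ s → s ≤ t → t ≤ 1 → |φ t - φ s| ≤ a * (t - s) + C * (t - s) ^ 2) :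
    |φ 1 - φ 0| ≤ a := by
  have key : ∀ N : ℕ, |φ 1 - φ 0| ≤ a + C * (1 / ((N : ℝ) + 1)) := by
    intro N
    have hN : (0 : ℝ) < (N : ℝ) + 1 := by positivity
    have hk : ∀ k : ℕ, k ≤ N + 1 → |φ (k / ((N : ℝ) + 1)) - φ 0| ≤
        k * (a * (1 / ((N : ℝ) + 1)) + C * (1 / ((N : ℝ) + 1)) ^ 2) := by
      intro k
      induction k with
      | zero => simp
      | succ k ih =>
        intro hk
        have h1 := ih (by omega)
        have hk' : ((k + 1 : ℕ) : ℝ) ≤ (N : ℝ) + 1 := by exact_mod_cast hk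
        have hd : ((k + 1 : ℕ) : ℝ) / ((N : ℝ) + 1) - k / ((N : ℝ) + 1) = 1 / ((N : ℝ) + 1) := by
          push_cast; ring
        have h2 := h (k / ((N : ℝ) + 1)) ((k + 1 : ℕ) / ((N : ℝ) + 1)) (by positivity)
          (by rw [← sub_nonneg, hd]; positivity) (by rw [div_le_one hN]; exact hk')
        rw [hd] at h2
        have h3 := abs_sub_le (φ ((k + 1 : ℕ) / ((N : ℝ) + 1))) (φ (k / ((N : ℝ) + 1))) (φ 0)
        push_cast at *
        linarith
    have := hk (N + 1) le_rfl
    push_cast at this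
    rw [div_self hN.ne'] at this
    refine this.trans (le_of_eq ?_)
    field_simp
  have hlim : Tendsto (fun N : ℕ => a + C * (1 / ((N : ℝ) + 1))) atTop (𝓝 (a + C * 0)) :=
    (tendsto_one_div_add_atTop_nhds_zero_nat.const_mul C).const_add a
  rw [mul_zero, add_zero] at hlim
  exact ge_of_tendsto' hlim key

/-- A convex function has a second order expansion wherever its subgradient is differentiable. -/
theorem IsSubgradient.second_order_expansion {f : E → ℝ} {g : E → E} (hg : IsSubgradient f g)
    {z : E} {A : E →L[ℝ] E} (hA : HasFDerivAt g A z) {ε : ℝ} (hε : 0 < ε) :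
    ∀ᶠ y in 𝓝 z, |f y - f z - ⟪g z, y - z⟫ - 1 / 2 * ⟪A (y - z), y - z⟫| ≤ ε * ‖y - z‖ ^ 2 := by
  have hA' := (hasFDerivAt_iff_isLittleO.1 hA).def hε
  obtain ⟨r, hr, hball⟩ := Metric.eventually_nhds_iff_ball.1 hA'
  refine Metric.eventually_nhds_iff_ball.2 ⟨r, hr, fun y hy => ?_⟩
  set h := y - z with hh
  have hseg : ∀ t : ℝ, 0 ≤ t → t ≤ 1 →
      |⟪g (z + t • h), h⟫ - ⟪g z, h⟫ - t * ⟪A h, h⟫| ≤ ε * t * ‖h‖ ^ 2 := by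
    intro t ht0 ht1
    have hmem : z + t • h ∈ ball z r := by
      rw [mem_ball_iff_norm, add_sub_cancel_left, norm_smul, Real.norm_of_nonneg ht0]
      rw [mem_ball_iff_norm] at hy
      nlinarith [norm_nonneg h]
    have h1 := hball _ hmem
    rw [add_sub_cancel_left, map_smul, norm_smul, Real.norm_of_nonneg ht0] at h1
    have h2 : ⟪g (z + t • h), h⟫ - ⟪g z, h⟫ - t * ⟪A h, h⟫ =
        ⟪g (z + t • h) - g z - t • A h, h⟫ := by
      simp only [inner_sub_left, real_inner_smul_left]
    rw [h2]
    calc _ ≤ ‖g (z + t • h) - g z - t • A h‖ * ‖h‖ := abs_real_inner_le_norm _ _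
      _ ≤ (ε * (t * ‖h‖)) * ‖h‖ := by gcongr
      _ = _ := by ring
  have hmono : ∀ s t : ℝ, f (z + s • h) + (t - s) * ⟪g (z + s • h), h⟫ ≤ f (z + t • h) := by
    intro s t
    have := hg (z + s • h) (z + t • h)
    rwa [add_sub_add_left_eq_sub, ← sub_smul, inner_smul_right] at this
  set φ : ℝ → ℝ := fun t => f (z + t • h) - t * ⟪g z, h⟫ - t ^ 2 / 2 * ⟪A h, h⟫ with hφ
  have hmain : |φ 1 - φ 0| ≤ ε * ‖h‖ ^ 2 := by
    -- The subgradient inequalities at both ends squeeze the increment; using an end instead of the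
    -- midpoint `(s + t) / 2` costs `(t - s)² / 2 * |⟪A h, h⟫|`, whence `C`.
    refine abs_sub_le_of_forall_abs_sub_le (C := |⟪A h, h⟫|) fun s t hs hst ht => ?_
    have h1 := abs_le.1 (hseg s hs (hst.trans ht))
    have h2 := abs_le.1 (hseg t (hs.trans hst) ht)
    have h3 := hmono s t
    have h4 := hmono t s
    have hts : 0 ≤ t - s := sub_nonneg.2 hst
    have h5 := mul_le_mul_of_nonneg_left h1.1 hts
    have h6 := mul_le_mul_of_nonneg_left h2.2 hts
    have h7 : (t - s) * (ε * s * ‖h‖ ^ 2) ≤ ε * ‖h‖ ^ 2 * (t - s) := by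
      have : s * (ε * ‖h‖ ^ 2 * (t - s)) ≤ 1 * (ε * ‖h‖ ^ 2 * (t - s)) := by
        gcongr; exact hst.trans ht
      linarith
    have h8 : (t - s) * (ε * t * ‖h‖ ^ 2) ≤ ε * ‖h‖ ^ 2 * (t - s) := by
      have : t * (ε * ‖h‖ ^ 2 * (t - s)) ≤ 1 * (ε * ‖h‖ ^ 2 * (t - s)) := by gcongr
      linarith
    have h9 := mul_le_mul_of_nonneg_right (le_abs_self ⟪A h, h⟫) (sq_nonneg (t - s))
    have h10 := mul_le_mul_of_nonneg_right (neg_abs_le ⟪A h, h⟫) (sq_nonneg (t - s))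
    have h11 : 0 ≤ |⟪A h, h⟫| * (t - s) ^ 2 := by positivity
    rw [abs_le]
    constructor <;> simp only [hφ] <;> nlinarith
  simp only [hφ, one_smul, zero_smul, add_zero, hh, add_sub_cancel] at hmain
  refine le_of_eq_of_le ?_ hmain
  congr 1
  ring

end Subgradient

/-! ### From differentiability on a set to differentiability at its density points -/

section Density

variable {E : Type*} [NormedAddCommGroup E] [NormedSpace ℝ E]

/-- Replace `y` by `y' ∈ s` at distance `o(‖y - z‖)`; calmness at `y'` makes the change of `g`
equally small. -/
theorem HasFDerivWithinAt.hasFDerivAt_of_calm {F : Type*} [NormedAddCommGroup F] [NormedSpace ℝ F]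
    {g : E → F} {A : E →L[ℝ] F} {s : Set E} {z : E} (hA : HasFDerivWithinAt g A s z)
    (hdense : ∀ ε > 0, ∀ᶠ y in 𝓝 z, ∃ y' ∈ s, ‖y - y'‖ ≤ ε * ‖y - z‖)
    {c r : ℝ} (hr : 0 < r) (hc : 0 ≤ c)
    (hcalm : ∀ y' ∈ s, ∀ y, ‖y - y'‖ ≤ r → ‖g y - g y'‖ ≤ c * ‖y - y'‖) :
    HasFDerivAt g A z := by
  rw [hasFDerivAt_iff_isLittleO, Asymptotics.isLittleO_iff]
  intro ε hε
  obtain ⟨η, hη, hη1, hηε⟩ : ∃ η > 0, η ≤ 1 ∧ c * η + η * 2 + ‖A‖ * η ≤ ε := by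
    refine ⟨min 1 (ε / (c + 2 + ‖A‖)), by positivity, min_le_left _ _, ?_⟩
    have hpos : 0 < c + 2 + ‖A‖ := by positivity
    have := min_le_right 1 (ε / (c + 2 + ‖A‖))
    rw [le_div_iff₀ hpos] at this
    linarith
  have hA' := (hasFDerivWithinAt_iff_isLittleO.1 hA).def hη
  obtain ⟨t, ht, hball⟩ := Metric.eventually_nhds_iff_ball.1 (eventually_nhdsWithin_iff.1 hA')
  filter_upwards [hdense η hη, Metric.ball_mem_nhds z (half_pos ht), Metric.ball_mem_nhds z hr]
    with y ⟨y', hy's, hy'⟩ hyt hyr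
  rw [mem_ball_iff_norm] at hyt hyr
  have hn := norm_nonneg (y - z)
  have h0 : ‖y - y'‖ ≤ ‖y - z‖ := hy'.trans (by nlinarith)
  have h1 : ‖y' - z‖ ≤ 2 * ‖y - z‖ := by
    calc ‖y' - z‖ = ‖(y - z) - (y - y')‖ := by congr 1; abel
      _ ≤ ‖y - z‖ + ‖y - y'‖ := norm_sub_le _ _
      _ ≤ _ := by linarith
  have h2 := hball y' (by rw [mem_ball_iff_norm]; linarith) hy's
  have h3 := hcalm y' hy's y (by linarith)
  have h4 : g y - g z - A (y - z) = (g y - g y') + (g y' - g z - A (y' - z)) - A (y - y') := by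
    simp only [map_sub]; abel
  calc ‖g y - g z - A (y - z)‖ ≤ ‖g y - g y'‖ + ‖g y' - g z - A (y' - z)‖ + ‖A (y - y')‖ := by
        rw [h4]; exact (norm_sub_le _ _).trans (by gcongr; exact norm_add_le _ _)
    _ ≤ c * (η * ‖y - z‖) + η * (2 * ‖y - z‖) + ‖A‖ * (η * ‖y - z‖) := by
        gcongr
        · exact h3.trans (by gcongr)
        · exact h2.trans (by gcongr)
        · exact (A.le_opNorm _).trans (by gcongr)
    _ = (c * η + η * 2 + ‖A‖ * η) * ‖y - z‖ := by ring
    _ ≤ ε * ‖y - z‖ := by gcongr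

variable [FiniteDimensional ℝ E] [MeasurableSpace E] [BorelSpace E]

theorem ae_eventually_exists_mem_norm_sub_le (μ : Measure E) [μ.IsAddHaarMeasure] (s : Set E) :
    ∀ᵐ z ∂μ, z ∈ s → ∀ ε > 0, ∀ᶠ y in 𝓝 z, ∃ y' ∈ s, ‖y - y'‖ ≤ ε * ‖y - z‖ := by
  have h : ∀ᵐ z ∂μ, z ∈ s → ∀ N : ℕ, ∀ᶠ y in 𝓝[≠] z,
      ∃ y' ∈ s, ‖y - y'‖ ≤ 1 / ((N : ℝ) + 1) * ‖y - z‖ := by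
    have := ae_all_iff.2 fun N : ℕ =>
      IsUnifLocDoublingMeasure.ae_tendsto_measure_inter_div μ s ((N : ℝ) + 1)
    filter_upwards [ae_imp_of_ae_restrict this] with z hz hzs N
    have hN : (0 : ℝ) < (N : ℝ) + 1 := by positivity
    have hδ : Tendsto (fun y => 1 / ((N : ℝ) + 1) * ‖y - z‖) (𝓝[≠] z) (𝓝[>] 0) := by
      refine tendsto_nhdsWithin_iff.2 ⟨?_, ?_⟩
      · have : Continuous fun y => 1 / ((N : ℝ) + 1) * ‖y - z‖ := by fun_prop
        exact (this.tendsto' z 0 (by simp)).mono_left nhdsWithin_le_nhds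
      · filter_upwards [self_mem_nhdsWithin] with y hy
        have := norm_pos_iff.2 (sub_ne_zero.2 hy)
        exact Set.mem_Ioi.2 (by positivity)
    -- The density theorem is used for balls centred at `y`, not at `z`: the ball of radius `‖y - z‖
    -- / (N + 1)` contains `z` once dilated by `N + 1`. A nonzero density ratio means that it meets
    -- `s`.
    have hlim := hz hzs N (fun y : E => y) _ hδ (Eventually.of_forall fun y => by
      rw [mem_closedBall_iff_norm, norm_sub_rev]
      field_simp
      exact le_rfl)
    filter_upwards [hlim.eventually_ne one_ne_zero] with y hy
    have hne : (s ∩ closedBall y (1 / ((N : ℝ) + 1) * ‖y - z‖)).Nonempty := by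
      rw [Set.nonempty_iff_ne_empty]
      intro hemp
      exact hy (by rw [hemp, measure_empty, ENNReal.zero_div])
    obtain ⟨y', hy's, hy'⟩ := hne
    exact ⟨y', hy's, by rwa [mem_closedBall_iff_norm, norm_sub_rev] at hy'⟩
  filter_upwards [h] with z hz hzs ε hε
  obtain ⟨N, hN⟩ := exists_nat_one_div_lt hε
  filter_upwards [eventually_nhdsWithin_iff.1 (hz hzs N)] with y hy
  by_cases hyz : y = z
  · exact ⟨z, hzs, by simp [hyz]⟩
  · obtain ⟨y', hy's, hy'⟩ := hy hyz
    exact ⟨y', hy's, hy'.trans (by gcongr)⟩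

end Density

/-! ### Jensen's lemma for a sum of two convex functions -/

section Contact

variable {E : Type*} [NormedAddCommGroup E] [InnerProductSpace ℝ E]

theorem eq_of_eventually_inner_le {p q z : E} {c : ℝ}
    (h : ∀ᶠ y in 𝓝 z, ⟪p, y - z⟫ ≤ ⟪q, y - z⟫ + c * ‖y - z‖ ^ 2) : p = q := by
  have hlim : Tendsto (fun t : ℝ => z + t • (p - q)) (𝓝[>] 0) (𝓝 z) := by
    have : Continuous fun t : ℝ => z + t • (p - q) := by fun_prop
    exact (this.tendsto' 0 z (by simp)).mono_left nhdsWithin_le_nhds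
  have h1 : ∀ᶠ t : ℝ in 𝓝[>] 0, ‖p - q‖ ^ 2 ≤ t * (c * ‖p - q‖ ^ 2) := by
    filter_upwards [hlim.eventually h, self_mem_nhdsWithin] with t ht ht0
    have ht0 : 0 < t := ht0
    rw [add_sub_cancel_left, inner_smul_right, inner_smul_right, norm_smul,
      Real.norm_of_nonneg ht0.le] at ht
    have h2 : ⟪p, p - q⟫ - ⟪q, p - q⟫ = ‖p - q‖ ^ 2 := by
      rw [← inner_sub_left, real_inner_self_eq_norm_sq]
    refine le_of_mul_le_mul_left ?_ ht0
    have h3 : t * ⟪p, p - q⟫ - t * ⟪q, p - q⟫ = t * ‖p - q‖ ^ 2 := by rw [← h2]; ring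
    linarith
  have h3 : Tendsto (fun t : ℝ => t * (c * ‖p - q‖ ^ 2)) (𝓝[>] 0) (𝓝 0) := by
    have : Continuous fun t : ℝ => t * (c * ‖p - q‖ ^ 2) := by fun_prop
    exact (this.tendsto' 0 0 (by simp)).mono_left nhdsWithin_le_nhds
  have h4 : ‖p - q‖ ^ 2 ≤ 0 := ge_of_tendsto h3 h1
  have h5 : ‖p - q‖ = 0 := by nlinarith [norm_nonneg (p - q)]
  exact sub_eq_zero.1 (norm_eq_zero.1 h5)

theorem inner_apply_self_le_of_eventually {A B : E →L[ℝ] E} {z : E}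
    (h : ∀ᶠ y in 𝓝 z, ⟪A (y - z), y - z⟫ ≤ ⟪B (y - z), y - z⟫) (v : E) : ⟪A v, v⟫ ≤ ⟪B v, v⟫ := by
  have hlim : Tendsto (fun t : ℝ => z + t • v) (𝓝[>] 0) (𝓝 z) := by
    have : Continuous fun t : ℝ => z + t • v := by fun_prop
    exact (this.tendsto' 0 z (by simp)).mono_left nhdsWithin_le_nhds
  obtain ⟨t, ht, ht0⟩ := ((hlim.eventually h).and self_mem_nhdsWithin).exists
  have ht0 : 0 < t := ht0
  simp only [add_sub_cancel_left, map_smul, inner_smul_right, real_inner_smul_left] at ht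
  exact le_of_mul_le_mul_left (le_of_mul_le_mul_left ht ht0) ht0

variable [MeasurableSpace E] [BorelSpace E]

theorem LipschitzOnWith.hausdorffMeasure_finrank_image_eq_zero {s : Set E} {g : E → E} {C : NNReal}
    (hg : LipschitzOnWith C g s) (hs : Measure.hausdorffMeasure (Module.finrank ℝ E) s = 0) :
    Measure.hausdorffMeasure (Module.finrank ℝ E) (g '' s) = 0 := by
  have := hg.hausdorffMeasure_image_le (d := Module.finrank ℝ E) (by positivity)
  rw [hs, mul_zero] at this
  exact le_antisymm this bot_le

variable [FiniteDimensional ℝ E]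

/-- If the sum of two convex functions `f₁ + f₂` is touched from above, near `x₀`, by all small
linear perturbations of a fixed quadratic function, then it is so at a point where the subgradients
of both functions are differentiable. -/
theorem exists_contact_hasFDerivAt {f₁ f₂ : E → ℝ} {g₁ g₂ : E → E} (h₁ : IsSubgradient f₁ g₁)
    (h₂ : IsSubgradient f₂ g₂) {x₀ b : E} {S : E →L[ℝ] E} {δ τ ρ : ℝ} (hδ : 0 < δ) (hτ : 0 < τ)
    (hρ : 5 * τ ≤ ρ)
    (hcontact : ∀ p : E, ‖p‖ < δ → ∃ z ∈ ball x₀ τ, ∀ y ∈ closedBall x₀ ρ,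
      f₁ y + f₂ y ≤ f₁ z + f₂ z + ⟪p + b + S (z - x₀), y - z⟫ + 1 / 2 * ⟪S (y - z), y - z⟫) :
    ∃ (z p : E) (A₁ A₂ : E →L[ℝ] E), ‖p‖ < δ ∧ z ∈ ball x₀ τ ∧
      (∀ y ∈ closedBall x₀ ρ,
        f₁ y + f₂ y ≤ f₁ z + f₂ z + ⟪p + b + S (z - x₀), y - z⟫ + 1 / 2 * ⟪S (y - z), y - z⟫) ∧
      p + b + S (z - x₀) = g₁ z + g₂ z ∧ HasFDerivAt g₁ A₁ z ∧ HasFDerivAt g₂ A₂ z := by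
  set K : Set E := {z | z ∈ ball x₀ τ ∧ ∃ p : E, ‖p‖ < δ ∧ ∀ y ∈ closedBall x₀ ρ,
      f₁ y + f₂ y ≤ f₁ z + f₂ z + ⟪p + b + S (z - x₀), y - z⟫ + 1 / 2 * ⟪S (y - z), y - z⟫}
    with hK
  have hS : ∀ v, 1 / 2 * ⟪S v, v⟫ ≤ ‖S‖ / 2 * ‖v‖ ^ 2 := fun v => by
    have h1 := real_inner_le_norm (S v) v
    have h2 : ‖S v‖ * ‖v‖ ≤ ‖S‖ * ‖v‖ * ‖v‖ := by gcongr; exact S.le_opNorm v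
    nlinarith
  have hgrad : ∀ z ∈ ball x₀ τ, ∀ p : E, (∀ y ∈ closedBall x₀ ρ,
      f₁ y + f₂ y ≤ f₁ z + f₂ z + ⟪p + b + S (z - x₀), y - z⟫ + 1 / 2 * ⟪S (y - z), y - z⟫) →
      p + b + S (z - x₀) = g₁ z + g₂ z := by
    intro z hz p hp
    refine (eq_of_eventually_inner_le (z := z) (c := ‖S‖ / 2) ?_).symm
    have hnhds : closedBall x₀ ρ ∈ 𝓝 z :=
      Filter.mem_of_superset (isOpen_ball.mem_nhds hz)
        (ball_subset_closedBall.trans (closedBall_subset_closedBall (by linarith)))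
    filter_upwards [hnhds] with y hy
    rw [inner_add_left]
    linarith [hp y hy, h₁ z y, h₂ z y, hS (y - z)]
  -- The calmness lemma, used at scale `2 * τ` (the diameter of the ball), needs the upper bound out
  -- to `4 * τ` from `z`, hence `5 * τ ≤ ρ`.
  have hclose : ∀ z ∈ ball x₀ τ, ∀ y, ‖y - z‖ ≤ 2 * (2 * τ) → y ∈ closedBall x₀ ρ := by
    intro z hz y hy
    rw [mem_ball_iff_norm] at hz
    rw [mem_closedBall_iff_norm]
    calc ‖y - x₀‖ = ‖(y - z) + (z - x₀)‖ := by congr 1; abel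
      _ ≤ ‖y - z‖ + ‖z - x₀‖ := norm_add_le _ _
      _ ≤ ρ := by linarith
  -- Subtracting the affine minorant of `f₂` from the bound on the sum leaves a paraboloid above
  -- `f₁` alone.
  have hcalm₁ : ∀ z ∈ K, ∀ y, ‖y - z‖ ≤ 2 * τ → ‖g₁ y - g₁ z‖ ≤ 2 * ‖S‖ * ‖y - z‖ := by
    rintro z ⟨hz, p, -, hp⟩ y hy
    refine h₁.norm_sub_le (fun y hy => ?_) (norm_nonneg S) hy
    have h3 := hp y (hclose z hz y hy)
    rw [hgrad z hz p hp, inner_add_left] at h3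
    linarith [h₂ z y, hS (y - z)]
  have hcalm₂ : ∀ z ∈ K, ∀ y, ‖y - z‖ ≤ 2 * τ → ‖g₂ y - g₂ z‖ ≤ 2 * ‖S‖ * ‖y - z‖ := by
    rintro z ⟨hz, p, -, hp⟩ y hy
    refine h₂.norm_sub_le (fun y hy => ?_) (norm_nonneg S) hy
    have h3 := hp y (hclose z hz y hy)
    rw [hgrad z hz p hp, inner_add_left] at h3
    linarith [h₁ z y, hS (y - z)]
  have hdiam : ∀ z ∈ K, ∀ y ∈ K, ‖y - z‖ ≤ 2 * τ := by
    rintro z ⟨hz, -⟩ y ⟨hy, -⟩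
    rw [mem_ball_iff_norm] at hz hy
    calc ‖y - z‖ = ‖(y - x₀) - (z - x₀)‖ := by congr 1; abel
      _ ≤ ‖y - x₀‖ + ‖z - x₀‖ := norm_sub_le _ _
      _ ≤ _ := by linarith
  have hlip₁ : LipschitzOnWith (2 * ‖S‖₊) g₁ K := LipschitzOnWith.of_dist_le_mul
    fun y hy z hz => by
      simpa [dist_eq_norm] using hcalm₁ z hz y (hdiam z hz y hy)
  have hlip₂ : LipschitzOnWith (2 * ‖S‖₊) g₂ K := LipschitzOnWith.of_dist_le_mul
    fun y hy z hz => by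
      simpa [dist_eq_norm] using hcalm₂ z hz y (hdiam z hz y hy)
  set μ : Measure E := Measure.hausdorffMeasure (Module.finrank ℝ E) with hμ
  -- By `hgrad` the tilt `p + b` is a Lipschitz function of the contact point, and its values fill
  -- `ball b δ`; a null `K` would have a null image.
  have hμK : μ K ≠ 0 := by
    intro h0
    have hlip : LipschitzOnWith (2 * ‖S‖₊ + 2 * ‖S‖₊ + ‖S‖₊)
        (fun z => g₁ z + g₂ z - S (z - x₀)) K := by
      refine (hlip₁.add hlip₂).sub ?_
      refine LipschitzOnWith.of_dist_le_mul fun y _ z _ => ?_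
      rw [dist_eq_norm, dist_eq_norm, ← map_sub, sub_sub_sub_cancel_right]
      exact S.le_opNorm _
    have h3 := hlip.hausdorffMeasure_finrank_image_eq_zero h0
    have h4 : ball b δ ⊆ (fun z => g₁ z + g₂ z - S (z - x₀)) '' K := by
      intro q hq
      rw [mem_ball_iff_norm] at hq
      obtain ⟨z, hz, hp⟩ := hcontact (q - b) hq
      refine ⟨z, ⟨hz, q - b, hq, hp⟩, ?_⟩
      have := hgrad z hz _ hp
      simp only [← this]
      abel
    exact (isOpen_ball.measure_pos μ (nonempty_ball.2 hδ)).ne' (measure_mono_null h4 h3)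
  obtain ⟨z, hzK, hdense, hd₁, hd₂⟩ : ∃ z ∈ K,
      (∀ ε > 0, ∀ᶠ y in 𝓝 z, ∃ y' ∈ K, ‖y - y'‖ ≤ ε * ‖y - z‖) ∧
      DifferentiableWithinAt ℝ g₁ K z ∧ DifferentiableWithinAt ℝ g₂ K z := by
    by_contra hcon
    push Not at hcon
    refine hμK (measure_mono_null (fun z hz => ?_) (ae_iff.1
      ((ae_eventually_exists_mem_norm_sub_le μ K).and
        ((hlip₁.ae_differentiableWithinAt_of_mem (μ := μ)).and
          (hlip₂.ae_differentiableWithinAt_of_mem (μ := μ))))))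
    rintro ⟨ha, hb, hc⟩
    exact hcon z hz (ha hz) (hb hz) (hc hz)
  obtain ⟨hz, p, hpδ, hp⟩ := hzK
  exact ⟨z, p, _, _, hpδ, hz, hp, hgrad z hz p hp,
    hd₁.hasFDerivWithinAt.hasFDerivAt_of_calm hdense (by positivity : 0 < 2 * τ) (by positivity)
      hcalm₁,
    hd₂.hasFDerivWithinAt.hasFDerivAt_of_calm hdense (by positivity : 0 < 2 * τ) (by positivity)
      hcalm₂⟩

end Contact

/-! ### Jets of quadratic functions and Taylor expansion -/

section Jets

variable {n : ℕ}

/-- The matrix of the symmetric part of an endomorphism of `ℝⁿ`. -/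
def symPart (n : ℕ) :
    (EuclideanSpace ℝ (Fin n) →L[ℝ] EuclideanSpace ℝ (Fin n)) →ₗ[ℝ] SymMat n where
  toFun A := ⟨Matrix.of fun i j =>
    1 / 2 * (⟪A (EuclideanSpace.single i 1), EuclideanSpace.single j 1⟫ +
      ⟪A (EuclideanSpace.single j 1), EuclideanSpace.single i 1⟫), by
    change Matrix.IsSymm _
    ext i j
    simp [add_comm]⟩
  map_add' A B := by
    ext i j
    simp only [add_apply, inner_add_left, Submodule.coe_add, Matrix.add_apply,
      Matrix.of_apply]
    ring
  map_smul' c A := by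
    ext i j
    simp only [smul_apply, real_inner_smul_left, Submodule.coe_smul,
      Matrix.smul_apply, Matrix.of_apply, RingHom.id_apply, smul_eq_mul]
    ring

theorem symPart_apply (A : EuclideanSpace ℝ (Fin n) →L[ℝ] EuclideanSpace ℝ (Fin n)) (i j : Fin n) :
    (symPart n A : Matrix (Fin n) (Fin n) ℝ) i j =
      1 / 2 * (⟪A (EuclideanSpace.single i 1), EuclideanSpace.single j 1⟫ +
        ⟪A (EuclideanSpace.single j 1), EuclideanSpace.single i 1⟫) := rfl

theorem symPart_mem_posCone {A : EuclideanSpace ℝ (Fin n) →L[ℝ] EuclideanSpace ℝ (Fin n)}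
    (hA : ∀ v, 0 ≤ ⟪A v, v⟫) : symPart n A ∈ posCone n := by
  refine Matrix.PosSemidef.of_dotProduct_mulVec_nonneg (symPart n A).2 fun x => ?_
  have hx : (∑ i, x i • EuclideanSpace.single i (1 : ℝ)) = WithLp.toLp 2 x := by
    ext j
    simp [Finset.sum_apply, Pi.single_apply]
  have h := hA (WithLp.toLp 2 x)
  rw [← hx] at h
  simp only [map_sum, map_smul, sum_inner, inner_sum, real_inner_smul_left, inner_smul_right] at h
  have h2 : (∑ i, ∑ j, x i * (x j * ⟪A (EuclideanSpace.single i 1), EuclideanSpace.single j 1⟫)) =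
      ∑ i, ∑ j, x i * (x j * ⟪A (EuclideanSpace.single j 1), EuclideanSpace.single i 1⟫) := by
    rw [Finset.sum_comm]
    exact Finset.sum_congr rfl fun i _ => Finset.sum_congr rfl fun j _ => by ring
  have h3 : star x ⬝ᵥ ((symPart n A : Matrix (Fin n) (Fin n) ℝ).mulVec x) =
      ∑ i, ∑ j, x i * (x j * ⟪A (EuclideanSpace.single i 1), EuclideanSpace.single j 1⟫) := by
    have : ∀ a b : ℝ, a = b → 1 / 2 * (a + b) = a := by intros; linarith
    rw [← this _ _ h2, ← Finset.sum_add_distrib, Finset.mul_sum]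
    simp only [dotProduct, Matrix.mulVec, Pi.star_apply, star_trivial, symPart_apply]
    refine Finset.sum_congr rfl fun i _ => ?_
    rw [← Finset.sum_add_distrib, Finset.mul_sum, Finset.mul_sum]
    exact Finset.sum_congr rfl fun j _ => by ring
  rw [h3, Finset.sum_comm]
  refine h.trans_eq (Finset.sum_congr rfl fun i _ => ?_)
  rw [Finset.mul_sum]
  exact Finset.sum_congr rfl fun j _ => by ring

variable {E : Type*} [NormedAddCommGroup E] [InnerProductSpace ℝ E]

theorem hasFDerivAt_quadratic [CompleteSpace E] (a : ℝ) (p z : E) (A : E →L[ℝ] E) (y : E) :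
    HasFDerivAt (fun y => a + ⟪p, y - z⟫ + 1 / 2 * ⟪A (y - z), y - z⟫)
      (innerSL ℝ (p + (1 / 2 : ℝ) • (A + A.adjoint) (y - z))) y := by
  have h1 : HasFDerivAt (fun y => y - z) (ContinuousLinearMap.id ℝ E) y :=
    (hasFDerivAt_id y).sub_const z
  have h2 : HasFDerivAt (fun y => A (y - z)) A y := by
    exact A.hasFDerivAt.comp y h1
  have h3 := (((innerSL ℝ p).hasFDerivAt.comp y h1).const_add a).add
    ((h2.inner ℝ h1).const_mul (1 / 2 : ℝ))
  refine (h3.congr_fderiv ?_)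
  ext v
  have h4 : ⟪A.adjoint (y - z), v⟫ = ⟪A v, y - z⟫ := by
    rw [A.adjoint_inner_left, real_inner_comm]
  simp only [add_apply, smul_apply, ContinuousLinearMap.comp_apply, innerSL_apply_apply,
    ContinuousLinearMap.id_apply, ContinuousLinearMap.prod_apply, fderivInnerCLM_apply,
    inner_add_left, real_inner_smul_left, h4, smul_eq_mul]

theorem contDiff_quadratic (a : ℝ) (p z : E) (A : E →L[ℝ] E) :
    ContDiff ℝ 2 (fun y => a + ⟪p, y - z⟫ + 1 / 2 * ⟪A (y - z), y - z⟫) := by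
  have h1 : ContDiff ℝ 2 (fun y : E => y - z) := contDiff_id.sub contDiff_const
  have h2 : ContDiff ℝ 2 (fun y : E => A (y - z)) := A.contDiff.comp h1
  exact (contDiff_const.add (contDiff_const.inner ℝ h1)).add (contDiff_const.mul (h2.inner ℝ h1))

/-- No symmetry of `A` is assumed, since derivatives of subgradients are not shown to be symmetric;
the jet sees only the symmetric part. -/
theorem jet2At_quadratic (a : ℝ) (p z : EuclideanSpace ℝ (Fin n))
    (A : EuclideanSpace ℝ (Fin n) →L[ℝ] EuclideanSpace ℝ (Fin n)) :
    jet2At (fun y => a + ⟪p, y - z⟫ + 1 / 2 * ⟪A (y - z), y - z⟫) z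
      (contDiff_quadratic a p z A).contDiffAt = (a, p, symPart n A) := by
  have hgrad : gradient (fun y => a + ⟪p, y - z⟫ + 1 / 2 * ⟪A (y - z), y - z⟫) z = p := by
    refine HasGradientAt.gradient ?_
    rw [hasGradientAt_iff_hasFDerivAt]
    refine (hasFDerivAt_quadratic a p z A z).congr_fderiv ?_
    ext v
    simp
  have hfd : fderiv ℝ (fun y => a + ⟪p, y - z⟫ + 1 / 2 * ⟪A (y - z), y - z⟫) =
      fun y => innerSL ℝ (p + (1 / 2 : ℝ) • (A + A.adjoint) (y - z)) :=
    funext fun y => (hasFDerivAt_quadratic a p z A y).fderiv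
  have hfd2 : HasFDerivAt
      (fun y => innerSL ℝ (p + (1 / 2 : ℝ) • (A + A.adjoint) (y - z)))
      ((innerSL ℝ).comp ((1 / 2 : ℝ) • (A + A.adjoint))) z := by
    refine (innerSL ℝ).hasFDerivAt.comp z (HasFDerivAt.const_add p ?_)
    have h1 : HasFDerivAt (fun y => y - z) (ContinuousLinearMap.id ℝ _) z :=
      (hasFDerivAt_id z).sub_const z
    exact ((1 / 2 : ℝ) • (A + A.adjoint)).hasFDerivAt.comp z h1
  unfold jet2At
  refine Prod.ext (by simp) (Prod.ext hgrad (Subtype.ext ?_))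
  ext i j
  rw [symPart_apply]
  simp only [hessianMatrix, hfd, hfd2.fderiv, Matrix.of_apply]
  simp only [ContinuousLinearMap.comp_apply, innerSL_apply_apply, smul_apply, add_apply,
    real_inner_smul_left, inner_add_left, ContinuousLinearMap.adjoint_inner_left]
  rw [real_inner_comm (EuclideanSpace.single i 1) (A (EuclideanSpace.single j 1))]

theorem exists_quadratic_approx {φ : EuclideanSpace ℝ (Fin n) → ℝ} {x : EuclideanSpace ℝ (Fin n)}
    (hφ : ContDiffAt ℝ 2 φ x) :
    ∃ (q : EuclideanSpace ℝ (Fin n)) (A : EuclideanSpace ℝ (Fin n) →L[ℝ] EuclideanSpace ℝ (Fin n)),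
      (∀ v w, ⟪A v, w⟫ = ⟪v, A w⟫) ∧ jet2At φ x hφ = (φ x, q, symPart n A) ∧
      ∀ ε > 0, ∀ᶠ y in 𝓝 x,
        |φ y - (φ x + ⟪q, y - x⟫ + 1 / 2 * ⟪A (y - x), y - x⟫)| ≤ ε * ‖y - x‖ ^ 2 := by
  set D := fderiv ℝ (fderiv ℝ φ) x with hD
  have hsymm : IsSymmSndFDerivAt ℝ φ x := hφ.isSymmSndFDerivAt (by simp)
  set A : EuclideanSpace ℝ (Fin n) →L[ℝ] EuclideanSpace ℝ (Fin n) :=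
    LinearMap.toContinuousLinearMap
      { toFun := fun v => (InnerProductSpace.toDual ℝ (EuclideanSpace ℝ (Fin n))).symm (D v)
        map_add' := fun v w => by simp
        map_smul' := fun c v => by simp } with hA
  have hAD : ∀ v w, ⟪A v, w⟫ = D v w := fun v w => by simp [hA]
  have hAsymm : ∀ v w, ⟪A v, w⟫ = ⟪v, A w⟫ := fun v w => by
    rw [hAD, real_inner_comm, hAD]; exact hsymm v w
  have hself : A.adjoint = A := by
    refine ContinuousLinearMap.ext fun v => ext_inner_right ℝ fun w => ?_
    rw [ContinuousLinearMap.adjoint_inner_left, hAsymm]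
  have hdiff : HasFDerivAt (fderiv ℝ φ) D x :=
    ((hφ.fderiv_right (m := 1) (by norm_num)).differentiableAt (by norm_num)).hasFDerivAt
  refine ⟨gradient φ x, A, hAsymm, ?_, fun ε hε => ?_⟩
  · unfold jet2At
    refine Prod.ext rfl (Prod.ext rfl (Subtype.ext ?_))
    ext i j
    rw [symPart_apply, hAD, hAD]
    have := hsymm (EuclideanSpace.single i 1) (EuclideanSpace.single j 1)
    simp only [hessianMatrix, Matrix.of_apply, hD]
    linarith
  · have hev : ∀ᶠ y in 𝓝 x, DifferentiableAt ℝ φ y :=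
      (hφ.eventually (by simp)).mono fun y hy => hy.differentiableAt (by norm_num)
    obtain ⟨r, hr, hball⟩ := Metric.eventually_nhds_iff_ball.1
      (hev.and ((hasFDerivAt_iff_isLittleO.1 hdiff).def hε))
    refine Metric.eventually_nhds_iff_ball.2 ⟨r, hr, fun y hy => ?_⟩
    rw [mem_ball_iff_norm] at hy
    -- Mean value inequality for the Taylor remainder on the ball of radius `‖y - x‖`, where its
    -- derivative is at most `ε * ‖y - x‖`.
    have hmv := (convex_closedBall x ‖y - x‖).norm_image_sub_le_of_norm_hasFDerivWithin_le
      (f := fun w => φ w - (φ x + ⟪gradient φ x, w - x⟫ + 1 / 2 * ⟪A (w - x), w - x⟫))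
      (f' := fun w => fderiv ℝ φ w -
        innerSL ℝ (gradient φ x + (1 / 2 : ℝ) • (A + A.adjoint) (w - x)))
      (C := ε * ‖y - x‖) (x := x) (y := y) (fun w hw => ?_) (fun w hw => ?_) (by simp)
      (by simp [dist_eq_norm])
    · simp only [sub_self, inner_zero_right, mul_zero, add_zero, map_zero, sub_zero,
        Real.norm_eq_abs] at hmv
      exact hmv.trans (le_of_eq (by ring))
    · have hw' : w ∈ ball x r := closedBall_subset_ball hy hw
      exact ((hball w hw').1.hasFDerivAt.sub
        (hasFDerivAt_quadratic _ _ _ _ w)).hasFDerivWithinAt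
    · have hw' : w ∈ ball x r := closedBall_subset_ball hy hw
      rw [mem_closedBall_iff_norm] at hw
      refine le_trans (le_of_eq ?_) ((hball w hw').2.trans (by gcongr))
      congr 1
      ext v
      have h1 : ⟪gradient φ x, v⟫ = fderiv ℝ φ x v := by
        simp [gradient]
      have h2 := hAD (w - x) v
      simp only [hself, sub_apply, innerSL_apply_apply, inner_add_left,
        real_inner_smul_left, add_apply, h1, h2]
      ring

end Jets

/-! ### Sup-convolution -/

section SupConvolution

/-- The sup-convolution of `u` over a compact set, together with a choice of maximizers. -/
theorem exists_supConvolution {E : Type*} [NormedAddCommGroup E] {u : E → EReal} {B : Set E} (hB : IsCompact B)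
    (hu : UpperSemicontinuousOn u B) (htop : ∀ x ∈ B, u x < ⊤) {x₀ : E} (hx₀ : x₀ ∈ B)
    (hbot : u x₀ ≠ ⊥) (k : ℝ) :
    ∃ (U : E → ℝ) (Y : E → E), ∀ x, Y x ∈ B ∧ u (Y x) = ((U x + k / 2 * ‖x - Y x‖ ^ 2 : ℝ) : EReal) ∧
      ∀ y ∈ B, u y ≤ ((U x + k / 2 * ‖x - y‖ ^ 2 : ℝ) : EReal) := by
  have key : ∀ x, ∃ (a : ℝ) (y : E), y ∈ B ∧ u y = ((a + k / 2 * ‖x - y‖ ^ 2 : ℝ) : EReal) ∧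
      ∀ y ∈ B, u y ≤ ((a + k / 2 * ‖x - y‖ ^ 2 : ℝ) : EReal) := by
    intro x
    have hcont : Continuous fun y : E => ((-(k / 2 * ‖x - y‖ ^ 2) : ℝ) : EReal) :=
      continuous_coe_real_ereal.comp (by fun_prop)
    have husc : UpperSemicontinuousOn (fun y => u y + ((-(k / 2 * ‖x - y‖ ^ 2) : ℝ) : EReal)) B :=
      hu.add' (hcont.upperSemicontinuous.upperSemicontinuousOn B) fun y _ =>
        EReal.continuousAt_add (Or.inr (EReal.coe_ne_bot _)) (Or.inr (EReal.coe_ne_top _))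
    obtain ⟨y, hyB, hy⟩ := husc.exists_isMaxOn ⟨x₀, hx₀⟩ hB
    have hyb : u y ≠ ⊥ := by
      intro h
      have h1 := hy hx₀
      simp only [Set.mem_ofPred_eq, h, EReal.bot_add, le_bot_iff, EReal.add_eq_bot_iff,
        EReal.coe_ne_bot, or_false] at h1
      exact hbot h1
    lift u y to ℝ using ⟨(htop y hyB).ne, hyb⟩ with c hc
    refine ⟨c - k / 2 * ‖x - y‖ ^ 2, y, hyB, by rw [← hc]; simp, fun y' hy' => ?_⟩
    by_cases hb' : u y' = ⊥
    · simp [hb']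
    have h1 := hy hy'
    simp only [Set.mem_ofPred_eq, ← hc] at h1
    lift u y' to ℝ using ⟨(htop y' hy').ne, hb'⟩ with c' hc'
    rw [← EReal.coe_add, ← EReal.coe_add, EReal.coe_le_coe_iff] at h1
    rw [EReal.coe_le_coe_iff]
    linarith
  choose U Y h using key
  exact ⟨U, Y, h⟩

variable {E : Type*} [NormedAddCommGroup E] [InnerProductSpace ℝ E]

/-- Adding a quadratic function makes a sup-convolution convex. -/
theorem isSubgradient_of_supConvolution {U : E → ℝ} {Y : E → E} {k : ℝ}
    (h : ∀ x y, U x + k / 2 * ‖x - Y x‖ ^ 2 ≤ U y + k / 2 * ‖y - Y x‖ ^ 2) (x₀ : E) :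
    IsSubgradient (fun x => U x + k / 2 * ‖x - x₀‖ ^ 2) (fun x => k • (Y x - x₀)) := by
  intro x y
  -- Expanding the squares about `x₀`, the terms quadratic in the free variable cancel: what remains
  -- is affine with slope `k • (Y x - x₀)`.
  have h1 := h x y
  have e1 : ‖x - Y x‖ ^ 2 = ‖x - x₀‖ ^ 2 - 2 * ⟪x - x₀, Y x - x₀⟫ + ‖Y x - x₀‖ ^ 2 := by
    rw [← norm_sub_sq_real, sub_sub_sub_cancel_right]
  have e2 : ‖y - Y x‖ ^ 2 = ‖y - x₀‖ ^ 2 - 2 * ⟪y - x₀, Y x - x₀⟫ + ‖Y x - x₀‖ ^ 2 := by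
    rw [← norm_sub_sq_real, sub_sub_sub_cancel_right]
  have e3 : ⟪Y x - x₀, y - x⟫ = ⟪y - x₀, Y x - x₀⟫ - ⟪x - x₀, Y x - x₀⟫ := by
    rw [← inner_sub_left, real_inner_comm]; congr 1; abel
  simp only [real_inner_smul_left, e3]
  rw [e1, e2] at h1
  linarith

/-- Upper quadratic test functions of the sup-convolution transfer to the original function. -/
theorem jet_mem_of_supConvolution {n : ℕ} {F : Set (Jet2 n)} (hF : PropertyN F)
    {u : EuclideanSpace ℝ (Fin n) → EReal} {B : Set (EuclideanSpace ℝ (Fin n))} {k : ℝ} (hk : 0 ≤ k)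
    {U : EuclideanSpace ℝ (Fin n) → ℝ} {z y p : EuclideanSpace ℝ (Fin n)}
    {A : EuclideanSpace ℝ (Fin n) →L[ℝ] EuclideanSpace ℝ (Fin n)}
    (hu : IsSubharmonicAt F u y) (hB : B ∈ 𝓝 y)
    (heq : u y = ((U z + k / 2 * ‖z - y‖ ^ 2 : ℝ) : EReal))
    (hle : ∀ x, ∀ w ∈ B, u w ≤ ((U x + k / 2 * ‖x - w‖ ^ 2 : ℝ) : EReal))
    (htest : ∀ᶠ x in 𝓝 z, U x ≤ U z + ⟪p, x - z⟫ + 1 / 2 * ⟪A (x - z), x - z⟫) :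
    (U z, p, symPart n A) ∈ F := by
  have h1 : (U z + k / 2 * ‖z - y‖ ^ 2, p, symPart n A) ∈ F := by
    rw [← jet2At_quadratic _ p y A]
    refine hu _ _ ?_ (by simp [heq])
    -- Translating the test function by `z - y` keeps the penalty constant; (N) removes that
    -- constant below.
    have hlim : Tendsto (fun w => z + (w - y)) (𝓝 y) (𝓝 z) := by
      have : Continuous fun w : EuclideanSpace ℝ (Fin n) => z + (w - y) := by fun_prop
      exact this.tendsto' y z (by simp)
    filter_upwards [hlim.eventually htest, hB] with w hw hwB
    refine (hle (z + (w - y)) w hwB).trans (EReal.coe_le_coe_iff.2 ?_)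
    rw [add_sub_cancel_left] at hw
    have h2 : z + (w - y) - w = z - y := by abel
    rw [h2]
    linarith
  have h2 := hF _ _ _ h1 (-(k / 2 * ‖z - y‖ ^ 2)) (by
    have : 0 ≤ k / 2 * ‖z - y‖ ^ 2 := by positivity
    linarith)
  rwa [add_neg_cancel_right] at h2

end SupConvolution

/-! ### The theorem on sums and subharmonic addition -/

theorem exists_le_coe_of_upperSemicontinuousOn {X : Type*} [TopologicalSpace X] {u : X → EReal}
    {B : Set X} (hB : IsCompact B) (hu : UpperSemicontinuousOn u B) (htop : ∀ x ∈ B, u x < ⊤) :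
    ∃ M : ℝ, ∀ x ∈ B, u x ≤ M := by
  rcases B.eq_empty_or_nonempty with rfl | hne
  · exact ⟨0, by simp⟩
  obtain ⟨y, hyB, hy⟩ := hu.exists_isMaxOn hne hB
  obtain ⟨M, hM, -⟩ := EReal.lt_iff_exists_real_btwn.1 (htop y hyB)
  exact ⟨M, fun x hx => (hy hx).trans hM.le⟩

theorem UpperSemicontinuousOn.add_of_lt_top {X : Type*} [TopologicalSpace X] {u v : X → EReal}
    {B : Set X} (hu : UpperSemicontinuousOn u B) (hv : UpperSemicontinuousOn v B)
    (hut : ∀ x ∈ B, u x < ⊤) (hvt : ∀ x ∈ B, v x < ⊤) :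
    UpperSemicontinuousOn (fun x => u x + v x) B :=
  hu.add' hv fun x hx =>
    EReal.continuousAt_add (Or.inl (hut x hx).ne) (Or.inr (hvt x hx).ne)

/-- Doubled near-contact points with a strict upper barrier are close to the contact point. -/
theorem exists_forall_norm_sub_lt {E : Type*} [NormedAddCommGroup E] {u v : E → EReal} {B : Set E}
    (hB : IsCompact B) (hu : UpperSemicontinuousOn u B) (hv : UpperSemicontinuousOn v B)
    (hut : ∀ x ∈ B, u x < ⊤) (hvt : ∀ x ∈ B, v x < ⊤) {Q : E → ℝ} (hQ : Continuous Q) {x₀ : E}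
    (hlt : ∀ y ∈ B, y ≠ x₀ → u y + v y < Q y) {τ : ℝ} (hτ : 0 < τ) :
    ∃ γ > 0, ∀ z ∈ B, ∀ y ∈ B, ∀ y' ∈ B, ‖z - y‖ ≤ γ → ‖z - y'‖ ≤ γ →
      ((Q z - γ : ℝ) : EReal) ≤ u y + v y' → ‖z - x₀‖ < τ := by
  -- Otherwise counterexamples with `γ = 1 / (N + 1)` have a subsequence on which all three points
  -- tend to one `w ≠ x₀`; upper semicontinuity then contradicts `u w + v w < Q w`.
  by_contra hcon
  push Not at hcon
  have hpos : ∀ N : ℕ, (0 : ℝ) < 1 / ((N : ℝ) + 1) := fun N => by positivity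
  choose z hzB y hyB y' hyB' hzy hzy' hle hfar using fun N : ℕ => hcon _ (hpos N)
  obtain ⟨w, hwB, θ, hθ, hlim⟩ := hB.tendsto_subseq hzB
  have h0 : Tendsto (fun N => 1 / ((θ N : ℝ) + 1)) atTop (𝓝 0) :=
    tendsto_one_div_add_atTop_nhds_zero_nat.comp hθ.tendsto_atTop
  have hy : Tendsto (fun N => y (θ N)) atTop (𝓝 w) := by
    have h1 : Tendsto (fun N => z (θ N) - y (θ N)) atTop (𝓝 0) :=
      squeeze_zero_norm (fun N => hzy (θ N)) h0
    simpa using hlim.sub h1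
  have hy' : Tendsto (fun N => y' (θ N)) atTop (𝓝 w) := by
    have h1 : Tendsto (fun N => z (θ N) - y' (θ N)) atTop (𝓝 0) :=
      squeeze_zero_norm (fun N => hzy' (θ N)) h0
    simpa using hlim.sub h1
  have hwfar : τ ≤ ‖w - x₀‖ :=
    ge_of_tendsto' (hlim.sub_const x₀).norm fun N => hfar (θ N)
  have hw : w ≠ x₀ := by
    rintro rfl
    rw [sub_self, norm_zero] at hwfar
    linarith
  obtain ⟨c, hc1, hc2⟩ := EReal.lt_iff_exists_real_btwn.1 (hlt w hwB hw)
  have husc : UpperSemicontinuousOn (fun a : E × E => u a.1 + v a.2) (B ×ˢ B) :=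
    UpperSemicontinuousOn.add_of_lt_top (u := fun a : E × E => u a.1) (v := fun a : E × E => v a.2)
      (hu.comp continuousOn_fst fun a ha => ha.1) (hv.comp continuousOn_snd fun a ha => ha.2)
      (fun a ha => hut _ ha.1) (fun a ha => hvt _ ha.2)
  have hpair : Tendsto (fun N => (y (θ N), y' (θ N))) atTop (𝓝[B ×ˢ B] (w, w)) :=
    tendsto_nhdsWithin_iff.2 ⟨hy.prodMk_nhds hy',
      Eventually.of_forall fun N => ⟨hyB (θ N), hyB' (θ N)⟩⟩
  have hev1 := hpair.eventually (husc (w, w) ⟨hwB, hwB⟩ c hc1)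
  have hQlim : Tendsto (fun N => Q (z (θ N)) - 1 / ((θ N : ℝ) + 1)) atTop (𝓝 (Q w)) := by
    simpa using ((hQ.tendsto w).comp hlim).sub h0
  have hev2 := hQlim.eventually (lt_mem_nhds (EReal.coe_lt_coe_iff.1 hc2))
  obtain ⟨N, h1, h2⟩ := (hev1.and hev2).exists
  exact absurd ((hle (θ N)).trans_lt h1) (not_lt.2 (EReal.coe_le_coe_iff.2 h2.le))

/-- Strictness `η` confines near-contact points to a neighbourhood of `x₀`. Constants are chosen in
the order `τ`, `γ`, `δ`, `k`: localization, displacement of maximizers, size of the tilt, penalty.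
-/
theorem exists_jet_mem_of_add_le {n : ℕ} {F G H : Set (Jet2 n)} (hFN : PropertyN F)
    (hGN : PropertyN G) (hHP : PropertyP H) (hHN : PropertyN H) (hFGH : F + G ⊆ H)
    {u v : EuclideanSpace ℝ (Fin n) → EReal} {x₀ q : EuclideanSpace ℝ (Fin n)}
    {A : EuclideanSpace ℝ (Fin n) →L[ℝ] EuclideanSpace ℝ (Fin n)} {ρ η c : ℝ} (hρ : 0 < ρ)
    (hη : 0 < η) (hu : UpperSemicontinuousOn u (closedBall x₀ ρ))
    (hv : UpperSemicontinuousOn v (closedBall x₀ ρ))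
    (hut : ∀ x ∈ closedBall x₀ ρ, u x < ⊤) (hvt : ∀ x ∈ closedBall x₀ ρ, v x < ⊤)
    (huF : ∀ x ∈ closedBall x₀ ρ, IsSubharmonicAt F u x)
    (hvG : ∀ x ∈ closedBall x₀ ρ, IsSubharmonicAt G v x)
    (hA : ∀ v w, ⟪A v, w⟫ = ⟪v, A w⟫)
    (hle : ∀ y ∈ closedBall x₀ ρ, u y + v y ≤
      ((c + ⟪q, y - x₀⟫ + 1 / 2 * ⟪A (y - x₀), y - x₀⟫ - η * ‖y - x₀‖ ^ 2 : ℝ) : EReal))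
    (heq : u x₀ + v x₀ = c) {ε : ℝ} (hε : 0 < ε) :
    ∃ q', ‖q' - q‖ ≤ ε ∧
      (c - ε, q', symPart n A + ε • symPart n (ContinuousLinearMap.id ℝ _)) ∈ H := by
  set B := closedBall x₀ ρ with hBdef
  set Q : EuclideanSpace ℝ (Fin n) → ℝ :=
    fun y => c + ⟪q, y - x₀⟫ + 1 / 2 * ⟪A (y - x₀), y - x₀⟫ with hQdef
  have hBc : IsCompact B := isCompact_closedBall x₀ ρ
  have hx₀B : x₀ ∈ B := mem_closedBall_self hρ.le
  have hQc : Continuous Q := (contDiff_quadratic c q x₀ A).continuous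
  have hQ0 : Q x₀ = c := by simp [hQdef]
  have hub : u x₀ ≠ ⊥ := fun h => by simp [h] at heq
  have hvb : v x₀ ≠ ⊥ := fun h => by simp [h] at heq
  obtain ⟨M₁, hM₁⟩ := exists_le_coe_of_upperSemicontinuousOn hBc hu hut
  obtain ⟨M₂, hM₂⟩ := exists_le_coe_of_upperSemicontinuousOn hBc hv hvt
  obtain ⟨C, hC⟩ := hBc.exists_bound_of_continuousOn hQc.continuousOn
  obtain ⟨τ, hτ, hτρ, hτA, hτQ⟩ : ∃ τ > 0, 5 * τ ≤ ρ ∧ ‖A‖ * τ ≤ ε / 2 ∧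
      ∀ z, ‖z - x₀‖ < τ → c - ε / 2 ≤ Q z := by
    obtain ⟨t, ht, hball⟩ := Metric.eventually_nhds_iff_ball.1
      (hQc.continuousAt.eventually (lt_mem_nhds (by rw [hQ0]; linarith : c - ε / 2 < Q x₀)))
    refine ⟨min t (min (ρ / 5) (ε / 2 / (‖A‖ + 1))), by positivity, ?_, ?_, fun z hz => ?_⟩
    · have := (min_le_right t (min (ρ / 5) (ε / 2 / (‖A‖ + 1)))).trans (min_le_left _ _)
      linarith
    · have h1 := (min_le_right t (min (ρ / 5) (ε / 2 / (‖A‖ + 1)))).trans (min_le_right _ _)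
      rw [le_div_iff₀ (by positivity)] at h1
      have h2 : 0 < min t (min (ρ / 5) (ε / 2 / (‖A‖ + 1))) := by positivity
      linarith
    · exact (hball z (by rw [mem_ball_iff_norm]; exact hz.trans_le (min_le_left _ _))).le
  obtain ⟨γ₀, hγ₀, hnear⟩ := exists_forall_norm_sub_lt hBc hu hv hut hvt hQc (x₀ := x₀)
    (fun y hy hne => (hle y hy).trans_lt (EReal.coe_lt_coe_iff.2 (by
      have := norm_pos_iff.2 (sub_ne_zero.2 hne)
      have : 0 < η * ‖y - x₀‖ ^ 2 := by positivity
      simp only [hQdef]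
      linarith))) hτ
  obtain ⟨γ, hγ, hγγ₀, hγτ⟩ : ∃ γ > 0, γ ≤ γ₀ ∧ γ ≤ τ :=
    ⟨min γ₀ τ, by positivity, min_le_left _ _, min_le_right _ _⟩
  obtain ⟨δ, hδ, hδγ, hδε, hδε'⟩ : ∃ δ > 0, δ * ρ ≤ γ ∧ δ * ρ ≤ ε / 2 ∧ δ ≤ ε / 2 := by
    refine ⟨min (γ / ρ) (min (ε / 2 / ρ) (ε / 2)), by positivity, ?_, ?_, ?_⟩
    · rw [← le_div_iff₀ hρ]; exact min_le_left _ _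
    · rw [← le_div_iff₀ hρ]; exact (min_le_right _ _).trans (min_le_left _ _)
    · exact (min_le_right _ _).trans (min_le_right _ _)
  -- At a near-contact point the two penalties total at most `M₁ + M₂ + C + γ`, so neither maximizer
  -- can be farther than `γ`.
  obtain ⟨k, hk, hkγ⟩ : ∃ k : ℝ, 0 ≤ k ∧ M₁ + M₂ + C + γ < k / 2 * γ ^ 2 := by
    refine ⟨2 * (|M₁ + M₂ + C + γ| + 1) / γ ^ 2, by positivity, ?_⟩
    have : 2 * (|M₁ + M₂ + C + γ| + 1) / γ ^ 2 / 2 * γ ^ 2 = |M₁ + M₂ + C + γ| + 1 := by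
      field_simp
    rw [this]
    linarith [le_abs_self (M₁ + M₂ + C + γ)]
  obtain ⟨U, Y, hUY⟩ := exists_supConvolution hBc hu hut hx₀B hub k
  obtain ⟨V, Z, hVZ⟩ := exists_supConvolution hBc hv hvt hx₀B hvb k
  have hYle : ∀ x y, U x + k / 2 * ‖x - Y x‖ ^ 2 ≤ U y + k / 2 * ‖y - Y x‖ ^ 2 := fun x y => by
    have h := (hUY y).2.2 (Y x) (hUY x).1
    rwa [(hUY x).2.1, EReal.coe_le_coe_iff] at h
  have hZle : ∀ x y, V x + k / 2 * ‖x - Z x‖ ^ 2 ≤ V y + k / 2 * ‖y - Z x‖ ^ 2 := fun x y => by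
    have h := (hVZ y).2.2 (Z x) (hVZ x).1
    rwa [(hVZ x).2.1, EReal.coe_le_coe_iff] at h
  have hf := isSubgradient_of_supConvolution hYle x₀
  have hg := isSubgradient_of_supConvolution hZle x₀
  have hcontU : ∀ {W : EuclideanSpace ℝ (Fin n) → ℝ}
      {T : EuclideanSpace ℝ (Fin n) → EuclideanSpace ℝ (Fin n)}, (∀ x, T x ∈ B) →
      IsSubgradient (fun x => W x + k / 2 * ‖x - x₀‖ ^ 2) (fun x => k • (T x - x₀)) →
      Continuous W := by
    intro W T hT hW
    have h1 := (hW.lipschitzWith (C := ⟨k * ρ, by positivity⟩) fun x => by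
      rw [norm_smul, Real.norm_of_nonneg hk]
      have := mem_closedBall_iff_norm.1 (hT x)
      change _ ≤ k * ρ
      gcongr).continuous
    have h2 : Continuous fun x : EuclideanSpace ℝ (Fin n) => k / 2 * ‖x - x₀‖ ^ 2 := by fun_prop
    exact (h1.sub h2).congr fun x => by simp
  have hUc : Continuous U := hcontU (fun x => (hUY x).1) hf
  have hVc : Continuous V := hcontU (fun x => (hVZ x).1) hg
  have hbase : c ≤ U x₀ + V x₀ := by
    have h1 := (hUY x₀).2.2 x₀ hx₀B
    have h2 := (hVZ x₀).2.2 x₀ hx₀B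
    have h3 := add_le_add h1 h2
    rw [heq, ← EReal.coe_add, EReal.coe_le_coe_iff] at h3
    simpa using h3
  have hclose : ∀ z ∈ B, Q z - δ * ρ ≤ U z + V z →
      ‖z - Y z‖ ≤ γ ∧ ‖z - Z z‖ ≤ γ ∧ ‖z - x₀‖ < τ := by
    intro z hz hzQ
    have h1 := hM₁ _ (hUY z).1
    have h2 := hM₂ _ (hVZ z).1
    rw [(hUY z).2.1, EReal.coe_le_coe_iff] at h1
    rw [(hVZ z).2.1, EReal.coe_le_coe_iff] at h2
    have h3 := neg_abs_le (Q z)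
    have h4 := hC z hz
    rw [Real.norm_eq_abs] at h4
    have h5 : 0 ≤ k / 2 * ‖z - Y z‖ ^ 2 := by positivity
    have h6 : 0 ≤ k / 2 * ‖z - Z z‖ ^ 2 := by positivity
    have hsq : ∀ t : ℝ, k / 2 * t ^ 2 < k / 2 * γ ^ 2 → t ≤ γ := fun t ht => by
      by_contra hlt
      push Not at hlt
      have : k / 2 * γ ^ 2 ≤ k / 2 * t ^ 2 := by gcongr
      linarith
    have hy : ‖z - Y z‖ ≤ γ := hsq _ (by linarith)
    have hy' : ‖z - Z z‖ ≤ γ := hsq _ (by linarith)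
    refine ⟨hy, hy', hnear z hz _ (hUY z).1 _ (hVZ z).1 (hy.trans hγγ₀) (hy'.trans hγγ₀) ?_⟩
    rw [(hUY z).2.1, (hVZ z).2.1, ← EReal.coe_add, EReal.coe_le_coe_iff]
    linarith
  -- Each summand is convexified by `k/2‖y - x₀‖²`, so the touching quadratic gains `2 * k` in its
  -- Hessian.
  set S := A + (2 * k) • ContinuousLinearMap.id ℝ (EuclideanSpace ℝ (Fin n)) with hS
  have hiff : ∀ z p y,
      (U y + k / 2 * ‖y - x₀‖ ^ 2 + (V y + k / 2 * ‖y - x₀‖ ^ 2) ≤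
        U z + k / 2 * ‖z - x₀‖ ^ 2 + (V z + k / 2 * ‖z - x₀‖ ^ 2) +
          ⟪p + q + S (z - x₀), y - z⟫ + 1 / 2 * ⟪S (y - z), y - z⟫) ↔
      U y + V y ≤ U z + V z + (Q y - Q z) + ⟪p, y - z⟫ := by
    intro z p y
    obtain ⟨d, rfl⟩ : ∃ d, y = z + d := ⟨y - z, by abel⟩
    have e1 : z + d - x₀ = (z - x₀) + d := by abel
    have e2 : ⟪A d, z - x₀⟫ = ⟪A (z - x₀), d⟫ := by rw [hA, real_inner_comm]
    simp only [hQdef, hS, add_sub_cancel_left, e1, norm_add_sq_real, map_add, inner_add_left,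
      inner_add_right, add_apply, smul_apply, ContinuousLinearMap.id_apply,
      real_inner_smul_left, real_inner_self_eq_norm_sq]
    constructor <;> intro h <;> linarith
  have hlow : ∀ z ∈ B, ∀ p, ‖p‖ < δ →
      (∀ y ∈ B, U y + V y ≤ U z + V z + (Q y - Q z) + ⟪p, y - z⟫) →
      Q z - δ * ρ ≤ U z + V z := by
    intro z hz p hp hmax
    have h1 := hmax x₀ hx₀B
    have h2 : ⟪p, x₀ - z⟫ ≤ δ * ρ := by
      refine (real_inner_le_norm _ _).trans ?_
      rw [norm_sub_rev]
      have := mem_closedBall_iff_norm.1 hz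
      gcongr
    linarith
  obtain ⟨z, p, A₁, A₂, hp, hz, hcontact, hgrad, hA₁, hA₂⟩ :=
    exists_contact_hasFDerivAt hf hg (x₀ := x₀) (b := q) (S := S) hδ hτ hτρ (by
      intro p hp
      have hcont : Continuous fun y => U y + V y - Q y - ⟪p, y⟫ := by fun_prop
      obtain ⟨z, hzB, hzmax⟩ := hBc.exists_isMaxOn ⟨x₀, hx₀B⟩ hcont.continuousOn
      have hmax : ∀ y ∈ B, U y + V y ≤ U z + V z + (Q y - Q z) + ⟪p, y - z⟫ := fun y hy => by
        have : U y + V y - Q y - ⟪p, y⟫ ≤ U z + V z - Q z - ⟪p, z⟫ := hzmax hy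
        rw [inner_sub_right]
        linarith
      exact ⟨z, mem_ball_iff_norm.2 (hclose z hzB (hlow z hzB p hp hmax)).2.2,
        fun y hy => (hiff z p y).2 (hmax y hy)⟩)
  have hzτ := mem_ball_iff_norm.1 hz
  have hzB : z ∈ B := mem_closedBall_iff_norm.2 (by linarith)
  have hQz := hlow z hzB p hp fun y hy => (hiff z p y).1 (hcontact y hy)
  obtain ⟨hzY, hzZ, -⟩ := hclose z hzB hQz
  have hnhds : ∀ w, ‖z - w‖ ≤ γ → B ∈ 𝓝 w := fun w hw => by
    refine Filter.mem_of_superset (isOpen_ball.mem_nhds ?_) ball_subset_closedBall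
    rw [mem_ball_iff_norm]
    calc ‖w - x₀‖ = ‖(z - x₀) - (z - w)‖ := by congr 1; abel
      _ ≤ ‖z - x₀‖ + ‖z - w‖ := norm_sub_le _ _
      _ < ρ := by linarith
  have hε₁ : 0 < ε / 8 := by positivity
  have hexp₁ := hf.second_order_expansion hA₁ hε₁
  have hexp₂ := hg.second_order_expansion hA₂ hε₁
  -- The error `ε/8 * ‖y - z‖²` is absorbed as `ε/4` in the Hessian, and `-k` undoes the
  -- convexification.
  have htest : ∀ {W : EuclideanSpace ℝ (Fin n) → ℝ} {g₀ : EuclideanSpace ℝ (Fin n)}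
      {A₀ : EuclideanSpace ℝ (Fin n) →L[ℝ] EuclideanSpace ℝ (Fin n)},
      (∀ᶠ y in 𝓝 z, |W y + k / 2 * ‖y - x₀‖ ^ 2 - (W z + k / 2 * ‖z - x₀‖ ^ 2) - ⟪g₀, y - z⟫ -
        1 / 2 * ⟪A₀ (y - z), y - z⟫| ≤ ε / 8 * ‖y - z‖ ^ 2) →
      ∀ᶠ y in 𝓝 z, W y ≤ W z + ⟪g₀ - k • (z - x₀), y - z⟫ +
        1 / 2 * ⟪(A₀ + (ε / 4 - k) • ContinuousLinearMap.id ℝ (EuclideanSpace ℝ (Fin n))) (y - z),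
          y - z⟫ := by
    intro W g₀ A₀ h
    filter_upwards [h] with y hy
    obtain ⟨d, rfl⟩ : ∃ d, y = z + d := ⟨y - z, by abel⟩
    have e1 : z + d - x₀ = (z - x₀) + d := by abel
    have h1 := (abs_le.1 hy).2
    simp only [add_sub_cancel_left, e1, norm_add_sq_real, inner_add_left, inner_sub_left,
      add_apply, smul_apply, ContinuousLinearMap.id_apply,
      real_inner_smul_left, real_inner_self_eq_norm_sq] at h1 ⊢
    linarith
  have hjet₁ := jet_mem_of_supConvolution hFN hk (huF _ (hUY z).1) (hnhds _ hzY) (hUY z).2.1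
    (fun x => (hUY x).2.2) (htest hexp₁)
  have hjet₂ := jet_mem_of_supConvolution hGN hk (hvG _ (hVZ z).1) (hnhds _ hzZ) (hVZ z).2.1
    (fun x => (hVZ x).2.2) (htest hexp₂)
  have hjet := hFGH (Set.add_mem_add hjet₁ hjet₂)
  rw [Prod.mk_add_mk, Prod.mk_add_mk] at hjet
  have hcomp : ∀ w, ⟪(A₁ + A₂) w, w⟫ ≤
      ⟪(S + (ε / 2) • ContinuousLinearMap.id ℝ (EuclideanSpace ℝ (Fin n))) w, w⟫ := by
    refine inner_apply_self_le_of_eventually (z := z) ?_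
    filter_upwards [hexp₁, hexp₂, hnhds z (by simpa using hγ.le)] with y h1 h2 hyB
    have h3 := hcontact y hyB
    rw [hgrad, inner_add_left] at h3
    simp only [add_apply, smul_apply, ContinuousLinearMap.id_apply, inner_add_left,
      real_inner_smul_left, real_inner_self_eq_norm_sq] at h1 h2 h3 ⊢
    linarith [(abs_le.1 h1).1, (abs_le.1 h2).1]
  -- Contact gives `A₁ + A₂ ≤ A + (2k + ε/2) I` as quadratic forms; the two corrections add `(ε/2 -
  -- 2k) I`, for a total of at most `A + ε I`.
  have hP : symPart n (A + ε • ContinuousLinearMap.id ℝ (EuclideanSpace ℝ (Fin n)) -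
      ((A₁ + (ε / 4 - k) • ContinuousLinearMap.id ℝ (EuclideanSpace ℝ (Fin n))) +
        (A₂ + (ε / 4 - k) • ContinuousLinearMap.id ℝ (EuclideanSpace ℝ (Fin n))))) ∈ posCone n := by
    refine symPart_mem_posCone fun w => ?_
    have h1 := hcomp w
    simp only [hS, add_apply, sub_apply, smul_apply, ContinuousLinearMap.id_apply, inner_add_left,
      inner_sub_left, real_inner_smul_left, real_inner_self_eq_norm_sq] at h1 ⊢
    linarith
  have hjetP := hHP _ _ _ hjet _ hP
  rw [← map_add, ← map_add, add_sub_cancel, map_add, map_smul] at hjetP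
  have hQτ := hτQ z hzτ
  -- `U z + V z ≥ Q z - δ * ρ ≥ c - ε`, so (N) may lower the value to `c - ε`.
  have hjetN := hHN _ _ _ hjetP (c - ε - (U z + V z)) (by linarith)
  rw [add_sub_cancel] at hjetN
  refine ⟨_, ?_, hjetN⟩
  have hq : k • (Y z - x₀) - k • (z - x₀) + (k • (Z z - x₀) - k • (z - x₀)) - q =
      p + A (z - x₀) := by
    have h1 : k • (Y z - x₀) - k • (z - x₀) + (k • (Z z - x₀) - k • (z - x₀)) - q =
      (k • (Y z - x₀) + k • (Z z - x₀)) - (2 * k) • (z - x₀) - q := by module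
    rw [h1, ← hgrad, hS]
    simp only [add_apply, smul_apply, ContinuousLinearMap.id_apply]
    abel
  rw [hq]
  calc ‖p + A (z - x₀)‖ ≤ ‖p‖ + ‖A (z - x₀)‖ := norm_add_le _ _
    _ ≤ ε / 2 + ‖A‖ * τ := by
      gcongr
      · linarith
      · exact (A.le_opNorm _).trans (by gcongr)
    _ ≤ ε := by linarith

variable {n : ℕ}

theorem PropertyT.isClosed {F : Set (Jet2 n)} (hF : PropertyT F) : IsClosed F := by
  rw [hF]
  exact isClosed_closure

/-- Jet addition implies addition for functions that are subharmonic. -/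
theorem subharmonics_add_subset {F G H : Set (Jet2 n)} (hFN : PropertyN F) (hGN : PropertyN G)
    (hHP : PropertyP H) (hHN : PropertyN H) (hHc : IsClosed H) (hFGH : F + G ⊆ H)
    {X : Set (EuclideanSpace ℝ (Fin n))} (hX : IsOpen X) :
    subharmonics F X + subharmonics G X ⊆ subharmonics H X := by
  rintro _ ⟨u, ⟨hu, hut, huF⟩, v, ⟨hv, hvt, hvG⟩, rfl⟩
  refine ⟨hu.add_of_lt_top hv hut hvt, fun x hx => EReal.add_lt_top (hut x hx).ne (hvt x hx).ne,
    fun x₀ hx₀ φ hφ hle heq => ?_⟩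
  obtain ⟨q, A, hA, hjet, happrox⟩ := exists_quadratic_approx hφ
  rw [hjet]
  set I := ContinuousLinearMap.id ℝ (EuclideanSpace ℝ (Fin n)) with hI
  have key : ∀ ε > 0, ∃ q', ‖q' - q‖ ≤ ε ∧
      (φ x₀ - ε, q', symPart n A + (5 * ε) • symPart n I) ∈ H := by
    intro ε hε
    obtain ⟨r, hr, hball⟩ := Metric.eventually_nhds_iff_ball.1
      (((hX.eventually_mem hx₀).and hle).and (happrox ε hε))
    have hρ : 0 < r / 2 := half_pos hr
    have hsub : ∀ x ∈ closedBall x₀ (r / 2), x ∈ ball x₀ r :=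
      closedBall_subset_ball (half_lt_self hr)
    have hBX : closedBall x₀ (r / 2) ⊆ X := fun x hx => (hball x (hsub x hx)).1.1
    -- Of the added `½ * 4ε = 2ε`, one `ε` pays for the Taylor error and one for strict contact; the
    -- lemma's own `ε` makes `5 * ε`.
    obtain ⟨q', hq', hmem⟩ := exists_jet_mem_of_add_le hFN hGN hHP hHN hFGH (x₀ := x₀) (q := q)
      (A := A + (4 * ε) • I) (c := φ x₀) hρ hε (hu.mono hBX) (hv.mono hBX)
      (fun x hx => hut x (hBX hx)) (fun x hx => hvt x (hBX hx)) (fun x hx => huF x (hBX hx))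
      (fun x hx => hvG x (hBX hx))
      (fun v w => by
        simp only [hI, add_apply, smul_apply, ContinuousLinearMap.id_apply, inner_add_left,
          inner_add_right, real_inner_smul_left, inner_smul_right, hA])
      (fun y hy => by
        obtain ⟨⟨-, h1⟩, h2⟩ := hball y (hsub y hy)
        refine h1.trans (EReal.coe_le_coe_iff.2 ?_)
        simp only [hI, add_apply, smul_apply, ContinuousLinearMap.id_apply, inner_add_left,
          real_inner_smul_left, real_inner_self_eq_norm_sq]
        linarith [(abs_le.1 h2).2])
      heq hε
    refine ⟨q', hq', ?_⟩
    rw [map_add, map_smul, add_assoc, ← add_smul] at hmem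
    convert hmem using 5
    ring
  have hpos : ∀ N : ℕ, (0 : ℝ) < 1 / ((N : ℝ) + 1) := fun N => by positivity
  choose q' hq' hmem using fun N : ℕ => key _ (hpos N)
  have h0 : Tendsto (fun N : ℕ => 1 / ((N : ℝ) + 1)) atTop (𝓝 0) :=
    tendsto_one_div_add_atTop_nhds_zero_nat
  have hq : Tendsto q' atTop (𝓝 q) :=
    tendsto_iff_norm_sub_tendsto_zero.2 (squeeze_zero (fun _ => norm_nonneg _) hq' h0)
  have hr : Tendsto (fun N : ℕ => φ x₀ - 1 / ((N : ℝ) + 1)) atTop (𝓝 (φ x₀)) := by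
    simpa using h0.const_sub (φ x₀)
  have hS : Tendsto (fun N : ℕ => symPart n A + (5 * (1 / ((N : ℝ) + 1))) • symPart n I) atTop
      (𝓝 (symPart n A)) := by
    simpa using ((h0.const_mul 5).smul_const (symPart n I)).const_add (symPart n A)
  exact hHc.mem_of_tendsto (hr.prodMk_nhds (hq.prodMk_nhds hS)) (Eventually.of_forall hmem)

/-! ### Dirichlet duality -/

section Duality

theorem mem_dirichletDual {F : Set (Jet2 n)} {J : Jet2 n} :
    J ∈ dirichletDual F ↔ -J ∉ interior F := Iff.rfl

theorem isClosed_dirichletDual (F : Set (Jet2 n)) : IsClosed (dirichletDual F) :=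
  isClosed_compl_iff.2 isOpen_interior.neg

/-- Complementation exchanges interior and closure, so the double dual is `closure (interior F)`. -/
theorem dirichletDual_dirichletDual {F : Set (Jet2 n)} (hF : PropertyT F) :
    dirichletDual (dirichletDual F) = F := by
  have h : -(interior (dirichletDual F)) = (closure (interior F))ᶜ := by
    rw [dirichletDual, interior_compl, ← neg_closure, Set.compl_neg, neg_neg]
  rw [dirichletDual, h, compl_compl, ← hF]

/-- If `-(J + K)` were interior to `G`, translating by `J ∈ F` would put a neighbourhood of `-K`
inside `H`, against `K` lying in the dual of `H`. -/
theorem add_dirichletDual_subset {F G H : Set (Jet2 n)} (h : F + G ⊆ H) :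
    F + dirichletDual H ⊆ dirichletDual G := by
  rintro _ ⟨J, hJ, K, hK, rfl⟩ hmem
  rw [mem_dirichletDual] at hK
  have hmem : -(J + K) ∈ interior G := hmem
  refine hK (mem_interior_iff_mem_nhds.2 ?_)
  have hlim : Filter.Tendsto (fun L : Jet2 n => L - J) (𝓝 (-K)) (𝓝 (-(J + K))) :=
    (continuous_sub_right J).tendsto' _ _ (by abel)
  filter_upwards [hlim.eventually (mem_interior_iff_mem_nhds.1 hmem)] with L hL
  simpa using h (Set.add_mem_add hJ hL)

/-- (N) says that certain translations map `F` into itself; `add_dirichletDual_subset` with a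
singleton passes each of them to the dual. -/
theorem PropertyN.dirichletDual {F : Set (Jet2 n)} (hF : PropertyN F) :
    PropertyN (dirichletDual F) := by
  intro r p A hJ s hs
  have h : {((s, 0, 0) : Jet2 n)} + F ⊆ F := by
    rintro _ ⟨_, rfl, ⟨r', p', A'⟩, hJ', rfl⟩
    simpa [add_comm] using hF r' p' A' hJ' s hs
  simpa [add_comm] using add_dirichletDual_subset h (Set.add_mem_add rfl hJ)

theorem PropertyP.dirichletDual {F : Set (Jet2 n)} (hF : PropertyP F) :
    PropertyP (dirichletDual F) := by
  intro r p A hJ P hP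
  have h : {((0, 0, P) : Jet2 n)} + F ⊆ F := by
    rintro _ ⟨_, rfl, ⟨r', p', A'⟩, hJ', rfl⟩
    simpa [add_comm] using hF r' p' A' hJ' P hP
  simpa [add_comm] using add_dirichletDual_subset h (Set.add_mem_add rfl hJ)

theorem IsMonotonicityCone.add_mem {M : Set (Jet2 n)} (hM : IsMonotonicityCone M) {J K : Jet2 n}
    (hJ : J ∈ M) (hK : K ∈ M) : J + K ∈ M := by
  have h := hM.smul_mem 2 zero_le_two _
    (hM.convex hJ hK one_half_pos.le one_half_pos.le (add_halves 1))
  rwa [smul_add, smul_smul, smul_smul, mul_one_div_cancel two_ne_zero, one_smul, one_smul] at h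

theorem IsMonotonicityCone.propertyN {M : Set (Jet2 n)} (hM : IsMonotonicityCone M) :
    PropertyN M := by
  intro r p A hJ s hs
  have h : ((s, 0, 0) : Jet2 n) ∈ M :=
    hM.minimal_subset ⟨hs, rfl, Matrix.PosSemidef.zero⟩
  simpa using hM.add_mem hJ h

theorem IsMonotonicityCone.propertyP {M : Set (Jet2 n)} (hM : IsMonotonicityCone M) :
    PropertyP M := by
  intro r p A hJ P hP
  have h : ((0, 0, P) : Jet2 n) ∈ M :=
    hM.minimal_subset ⟨Set.mem_Iic.2 le_rfl, rfl, hP⟩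
  simpa using hM.add_mem hJ h

end Duality

end

theorem mainTheorem3 (n : ℕ) :
    -- jet addition implies subharmonic addition
    (∀ F G H : Set (Jet2 n), IsSubequation F → IsSubequation G → IsSubequation H →
      F + G ⊆ H →
      ∀ X : Set (EuclideanSpace ℝ (Fin n)), IsOpen X →
        subharmonics F X + subharmonics G X ⊆ subharmonics H X) ∧
    -- jet addition, duality and monotonicity
    (∀ F H : Set (Jet2 n), IsSubequation F → IsSubequation H →
      (F + dirichletDual F ⊆ H ↔ F + dirichletDual H ⊆ F)) ∧
    (∀ F M : Set (Jet2 n), IsSubequation F → PropertyT M →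
      (IsMonotoneFor M F ↔ F + dirichletDual F ⊆ dirichletDual M)) ∧
    -- subharmonic addition, monotonicity and duality
    (∀ F M : Set (Jet2 n), IsSubequation F → IsMonotonicityConeSubequation M →
      IsMonotoneFor M F →
      ∀ X : Set (EuclideanSpace ℝ (Fin n)), IsOpen X →
        subharmonics F X + subharmonics (dirichletDual F) X ⊆
          subharmonics (dirichletDual M) X) := by
  refine ⟨fun F G H hF hG hH h X hX => subharmonics_add_subset hF.propertyN hG.propertyN
      hH.propertyP hH.propertyN hH.propertyT.isClosed h hX,
    fun F H hF hH => ⟨fun h => ?_, fun h => ?_⟩, fun F M hF hM => ⟨add_dirichletDual_subset,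
      fun h => ?_⟩, fun F M hF hM h X hX => ?_⟩
  · simpa only [dirichletDual_dirichletDual hF.propertyT] using add_dirichletDual_subset h
  · simpa only [dirichletDual_dirichletDual hH.propertyT] using add_dirichletDual_subset h
  · have h' := add_dirichletDual_subset h
    rwa [dirichletDual_dirichletDual hM, dirichletDual_dirichletDual hF.propertyT] at h'
  -- The duals need not be recognized as subequations: (N), (P) and closedness are enough for
  -- addition.
  · exact subharmonics_add_subset hF.propertyN hF.propertyN.dirichletDual
      hM.propertyP.dirichletDual hM.propertyN.dirichletDual (isClosed_dirichletDual M)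
      (add_dirichletDual_subset h) hX
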